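/- For an integer $m\ge 2$ let $F(m)$ be the set of all real numbers of the form $$[t,a_1,a_2,\dots]=t+\cfrac{1}{a_1+\cfrac{1}{a_2+\cfrac{1}{\ddots}}}$$ (the limit of the finite continued fractions $[t,a_1,\dots,a_n]$ as $n\to\infty$) with $t\in\mathbb{Z}$ and integers $1\le a_i\le m$ for all $i\ge 1$. Let $C\subset[0,1]$ be the middle-third Cantor set and $C+1=\{x+1 : x\in C\}$. Then $$\{x^3+y : x,y\in F(7)\}=\mathbb{R},\qquad \{x^3-y : x,y\in F(7)\}=\mathbb{R},$$ $$\{x^2+2y : x\in C+1,\ y\in F(6)\}=\mathbb{R},$$ $$\{0.1\,x+xy+z : x\in C+1,\ y\in C+1,\ z\in F(6)\}=\mathbb{R}.$$ -/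

import Mathlib

open Filter Topology

noncomputable section

/-- The infinite continued fraction `[t, a 0, a 1, …] = t + 1 / (a 0 + 1 / (a 1 + ⋯))`, as a formal
continued fraction with all partial numerators equal to `1`. -/
def infContFract (t : ℤ) (a : ℕ → ℕ) : GenContFract ℝ where
  h := t
  s := Stream'.Seq.ofStream fun n => ⟨1, (a n : ℝ)⟩

/-- `F m` is the set of the values `x = [t, a 0, a 1, …]` of infinite continued fractions with
`t` an arbitrary integer and all further partial quotients in `{1, …, m}`. The value is the limit
of the finite continued fractions `[t, a 0, …, a (n - 1)]`, which are evaluated directly. -/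
def contFractSet (m : ℕ) : Set ℝ :=
  {x | ∃ (t : ℤ) (a : ℕ → ℕ), (∀ i, 1 ≤ a i ∧ a i ≤ m) ∧
    Tendsto (infContFract t a).convs' atTop (𝓝 x)}

/-- The translate `C + 1` of the middle-third Cantor set `C`. -/
def cantorSetAddOne : Set ℝ := (fun x : ℝ => x + 1) '' cantorSet

end

/-! Each equation asks that the image of a Cantor-like set under a smooth increasing map meet F(6)
or -F(6). This follows from Newhouse's gap lemma: two interleaved closed sets whose thicknesses have
product at least 1 must intersect. If they were disjoint, a gap of one would be linked with a gap of
the other, and thickness would always produce a linked pair of smaller total length; compactness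
makes this descent stop (`inter_nonempty_of_isThick`). A map with slopes in [c₁, c₂] lowers
thickness by a factor of at most c₁ / c₂ (`exists_mem_of_isThick`).

The Cantor set has thickness 1 by self-similarity. The set `cfSet`, contained in F(6) and so in
F(7), has thickness at least 2.1 (`isThick_cfSet`). There the self-similarity x ↦ 1/x - k is only
projective, so the induction carries a weight: a Möbius map with denominator p + q x sends [a, b] to
an interval of length proportional to (b - a) / ((p + q a)(p + q b)), and thickness is proved for
all such images with 0 ≤ q ≤ p at once. Inversion and translation change only (p, q), until two
translates are separated and explicit estimates apply.

What remains is 10.53 / 3.93 ≤ 2.1² for the cube and 2 ≤ 2.1 for the square; in the last equation x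
= 1 leaves a sum. -/

/-! ### Gaps, thickness and the gap lemma. -/

/-- `(a, b)` is a bounded connected component of the complement of `S`. -/
structure IsGap (S : Set ℝ) (a b : ℝ) : Prop where
  left_mem : a ∈ S
  right_mem : b ∈ S
  lt : a < b
  le_or_le : ∀ x ∈ S, x ≤ a ∨ b ≤ x

/-- Any two gaps of `S` are separated by at least `τ` times the length of the shorter one. -/
def IsThick (τ : ℝ) (S : Set ℝ) : Prop :=
  ∀ a b c d, IsGap S a b → IsGap S c d → b ≤ c → τ * (b - a) ≤ c - b ∨ τ * (d - c) ≤ c - b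

/-- Every gap of `S` has distance at least `τ` times its length from `p` and from `q`. -/
def IsHullThick (τ : ℝ) (S : Set ℝ) (p q : ℝ) : Prop :=
  ∀ a b, IsGap S a b → τ * (b - a) ≤ a - p ∧ τ * (b - a) ≤ q - b

theorem IsClosed.exists_isGap {S : Set ℝ} (hS : IsClosed S) {x s t : ℝ} (hx : x ∉ S)
    (hs : s ∈ S) (hsx : s ≤ x) (ht : t ∈ S) (hxt : x ≤ t) :
    ∃ a b, IsGap S a b ∧ a < x ∧ x < b := by
  have h1 : (S ∩ Set.Iic x).Nonempty := ⟨s, hs, hsx⟩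
  have h2 : BddAbove (S ∩ Set.Iic x) := ⟨x, fun y hy => hy.2⟩
  have h3 : (S ∩ Set.Ici x).Nonempty := ⟨t, ht, hxt⟩
  have h4 : BddBelow (S ∩ Set.Ici x) := ⟨x, fun y hy => hy.2⟩
  have ha := (hS.inter isClosed_Iic).csSup_mem h1 h2
  have hb := (hS.inter isClosed_Ici).csInf_mem h3 h4
  have hax : sSup (S ∩ Set.Iic x) < x := lt_of_le_of_ne ha.2 fun h => hx (h ▸ ha.1)
  have hbx : x < sInf (S ∩ Set.Ici x) := lt_of_le_of_ne hb.2 fun h => hx (h ▸ hb.1)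
  refine ⟨_, _, ⟨ha.1, hb.1, hax.trans hbx, fun y hy => ?_⟩, hax, hbx⟩
  rcases le_total y x with h | h
  · exact Or.inl (le_csSup h2 ⟨hy, h⟩)
  · exact Or.inr (csInf_le h4 ⟨hy, h⟩)

/-- Distinct gaps are disjoint, so left endpoints of gaps of length at least ε are ε apart and have
distinct values of ⌊a / ε⌋. -/
theorem finite_setOf_isGap (S : Set ℝ) {ε : ℝ} (hε : 0 < ε) (P Q : ℝ) :
    {x : ℝ × ℝ | IsGap S x.1 x.2 ∧ ε ≤ x.2 - x.1 ∧ P ≤ x.1 ∧ x.1 ≤ Q}.Finite := by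
  have key : ∀ a b c d : ℝ, IsGap S a b → IsGap S c d → ε ≤ b - a → ⌊a / ε⌋ = ⌊c / ε⌋ →
      ¬ a < c := by
    intro a b c d h h' hab hf hac
    have hbc : b ≤ c := (h.le_or_le c h'.left_mem).resolve_left (not_le.2 hac)
    have h1 : a / ε + 1 ≤ c / ε := by
      rw [div_add_one hε.ne']
      gcongr
      linarith
    have h2 := Int.floor_mono h1
    rw [Int.floor_add_one] at h2
    omega
  refine Set.Finite.of_injOn (f := fun x : ℝ × ℝ => ⌊x.1 / ε⌋)
    (t := Set.Icc ⌊P / ε⌋ ⌊Q / ε⌋) ?_ ?_ (Set.finite_Icc _ _)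
  · rintro x ⟨-, -, hP, hQ⟩
    exact ⟨Int.floor_mono (by gcongr), Int.floor_mono (by gcongr)⟩
  · rintro ⟨a, b⟩ ⟨h, hab, -, -⟩ ⟨c, d⟩ ⟨h', hcd, -, -⟩ hf
    simp only at h h' hab hcd hf
    have hac : a = c := le_antisymm (not_lt.1 (key c d a b h' h hcd hf.symm))
      (not_lt.1 (key a b c d h h' hab hf))
    subst hac
    have hbd : b = d := le_antisymm ((h.le_or_le d h'.right_mem).resolve_left (not_le.2 h'.lt))
      ((h'.le_or_le b h.right_mem).resolve_left (not_le.2 h.lt))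
    rw [hbd]

/-- A form of Newhouse's gap lemma. -/
theorem inter_nonempty_of_isThick {A B : Set ℝ} {σ τ δ p q : ℝ} (hA : IsClosed A)
    (hB : IsClosed B) (hp : p ∈ A) (hq : q ∈ A) (hpq : A ⊆ Set.Icc p q) (tA : IsThick σ A)
    (hullA : IsHullThick σ A p q) (hBl : ∀ x, ∃ y ∈ B, y ≤ x) (hBu : ∀ x, ∃ y ∈ B, x ≤ y)
    (tB : IsThick τ B) (hδ : ∀ c d, IsGap B c d → d - c ≤ δ) (hδpq : δ < q - p)
    (hσ : 0 < σ) (hτ : 0 < τ) (hστ : 1 ≤ σ * τ) : (A ∩ B).Nonempty := by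
  by_contra hne
  have hdis : ∀ x, x ∈ A → x ∉ B := fun x hx hx' => hne ⟨x, hx, hx'⟩
  have gapA : ∀ x, x ∈ B → p ≤ x → x ≤ q → ∃ a b, IsGap A a b ∧ a < x ∧ x < b :=
    fun x hx h1 h2 => hA.exists_isGap (fun h => hdis x h hx) hp h1 hq h2
  have gapB : ∀ x, x ∈ A → ∃ a b, IsGap B a b ∧ a < x ∧ x < b := fun x hx => by
    obtain ⟨y, hy, hyx⟩ := hBl x
    obtain ⟨z, hz, hxz⟩ := hBu x
    exact hB.exists_isGap (hdis x hx) hy hyx hz hxz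
  obtain ⟨ε, hε, hεd⟩ : ∃ ε : ℝ, 0 < ε ∧ ∀ x ∈ A, ∀ y ∈ B, ε ≤ |x - y| := by
    have hc : IsCompact A := isCompact_Icc.of_isClosed_subset hA hpq
    obtain ⟨r, hr, h⟩ := Metric.exists_pos_forall_lt_edist hc hB
      (Set.disjoint_left.2 fun x hx => hdis x hx)
    refine ⟨r, hr, fun x hx y hy => ?_⟩
    have := h x hx y hy
    rw [edist_nndist, ENNReal.coe_lt_coe] at this
    have h2 : (r : ℝ) < dist x y := by exact_mod_cast this
    rw [Real.dist_eq] at h2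
    exact h2.le
  -- Linked pairs: the gaps overlap and neither contains the other.
  let T : Set ((ℝ × ℝ) × (ℝ × ℝ)) := {x | IsGap A x.1.1 x.1.2 ∧ IsGap B x.2.1 x.2.2 ∧
    (x.1.1 < x.2.1 ∧ x.2.1 < x.1.2 ∧ x.1.2 < x.2.2 ∨
      x.2.1 < x.1.1 ∧ x.1.1 < x.2.2 ∧ x.2.2 < x.1.2)}
  have hTfin : T.Finite := by
    -- The overlap runs between a point of A and a point of B, so both gaps have length at least ε.
    refine ((finite_setOf_isGap A hε p q).prod (finite_setOf_isGap B hε (p - δ) q)).subset ?_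
    rintro ⟨⟨a, b⟩, ⟨c, d⟩⟩ ⟨hab, hcd, h⟩
    simp only at hab hcd h
    have ha := hpq hab.left_mem
    have hb := hpq hab.right_mem
    have hl := hδ c d hcd
    rcases h with ⟨h1, h2, h3⟩ | ⟨h1, h2, h3⟩
    · have := hεd b hab.right_mem c hcd.left_mem
      rw [abs_of_pos (by linarith)] at this
      exact ⟨⟨hab, by simp only; linarith, ha.1, ha.2⟩,
        hcd, by simp only; linarith, by simp only; linarith [ha.1], by simp only; linarith [hb.2]⟩
    · have := hεd a hab.left_mem d hcd.right_mem
      rw [abs_of_neg (by linarith)] at this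
      exact ⟨⟨hab, by simp only; linarith, ha.1, ha.2⟩,
        hcd, by simp only; linarith, by simp only; linarith [ha.1], by simp only; linarith [hb.2]⟩
  -- The gap of B around p is too short to reach q, so its right end falls into a gap of A.
  have hTne : T.Nonempty := by
    obtain ⟨c, d, hcd, h1, h2⟩ := gapB p hp
    have hl := hδ c d hcd
    obtain ⟨a, b, hab, h3, h4⟩ := gapA d hcd.right_mem h2.le (by linarith)
    have := (hpq hab.left_mem).1
    exact ⟨((a, b), (c, d)), hab, hcd, Or.inr ⟨by simp only; linarith, h3, h4⟩⟩
  obtain ⟨⟨⟨a, b⟩, ⟨c, d⟩⟩, ⟨hab, hcd, h⟩, hmin⟩ :=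
    Set.exists_min_image T (fun x => (x.1.2 - x.1.1) + (x.2.2 - x.2.1)) hTfin hTne
  simp only at hab hcd h hmin
  have hcase : d - c ≤ σ * (b - a) ∨ b - a ≤ τ * (d - c) := by
    by_contra! hcon
    have h1 := mul_lt_mul_of_pos_left hcon.1 hτ
    have h2 := hab.lt
    nlinarith
  have hull := hullA a b hab
  rcases h with ⟨h1, h2, h3⟩ | ⟨h1, h2, h3⟩
  · rcases hcase with hc | hc
    -- Hull thickness keeps d below q, so d lies in a further gap of A. Its distance from b is less
    -- than d - c ≤ σ (b - a), so by thickness it is shorter than (a, b), and it is still linked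
    -- with (c, d). The other three cases are alike.
    · obtain ⟨a', b', hab', h4, h5⟩ := gapA d hcd.right_mem
        (by linarith [(hpq hab.right_mem).1]) (by linarith [hull.2])
      have hba' : b ≤ a' := (hab'.le_or_le b hab.right_mem).resolve_right (by linarith)
      have ht := (tA a b a' b' hab hab' hba').resolve_left (by linarith)
      have hlt : b' - a' < b - a := lt_of_mul_lt_mul_left (by linarith) hσ.le
      have := hmin ((a', b'), (c, d)) ⟨hab', hcd, Or.inr ⟨by simp only; linarith, h4, h5⟩⟩
      simp only at this
      linarith
    · obtain ⟨c', d', hcd', h4, h5⟩ := gapB a hab.left_mem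
      have hdc' : d' ≤ c := (hcd'.le_or_le c hcd.left_mem).resolve_left (by linarith)
      have ht := (tB c' d' c d hcd' hcd hdc').resolve_right (by linarith)
      have hlt : d' - c' < d - c := lt_of_mul_lt_mul_left (by linarith) hτ.le
      have := hmin ((a, b), (c', d')) ⟨hab, hcd', Or.inr ⟨h4, h5, by simp only; linarith⟩⟩
      simp only at this
      linarith
  · rcases hcase with hc | hc
    · obtain ⟨a', b', hab', h4, h5⟩ := gapA c hcd.left_mem
        (by linarith [hull.1]) (by linarith [(hpq hab.left_mem).2])
      have hba' : b' ≤ a := (hab'.le_or_le a hab.left_mem).resolve_left (by linarith)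
      have ht := (tA a' b' a b hab' hab hba').resolve_right (by linarith)
      have hlt : b' - a' < b - a := lt_of_mul_lt_mul_left (by linarith) hσ.le
      have := hmin ((a', b'), (c, d)) ⟨hab', hcd, Or.inl ⟨h4, h5, by simp only; linarith⟩⟩
      simp only at this
      linarith
    · obtain ⟨c', d', hcd', h4, h5⟩ := gapB b hab.right_mem
      have hdc' : d ≤ c' := (hcd'.le_or_le d hcd.right_mem).resolve_right (by linarith)
      have ht := (tB c d c' d' hcd hcd' hdc').resolve_left (by linarith)
      have hlt : d' - c' < d - c := lt_of_mul_lt_mul_left (by linarith) hτ.le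
      have := hmin ((a, b), (c', d')) ⟨hab, hcd', Or.inl ⟨by simp only; linarith, h4, h5⟩⟩
      simp only at this
      linarith

/-! ### Thickness under increasing maps and reflection. -/

/-- The gaps of the image of `A` under a strictly increasing map are the images of gaps of `A`. -/
theorem IsGap.exists_of_image {A : Set ℝ} {h : ℝ → ℝ} (hmono : StrictMonoOn h A) {u v : ℝ}
    (huv : IsGap (h '' A) u v) : ∃ a b, IsGap A a b ∧ h a = u ∧ h b = v := by
  obtain ⟨a, ha, rfl⟩ := huv.left_mem
  obtain ⟨b, hb, rfl⟩ := huv.right_mem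
  refine ⟨a, b, ⟨ha, hb, (hmono.lt_iff_lt ha hb).1 huv.lt, fun x hx => ?_⟩, rfl, rfl⟩
  exact (huv.le_or_le _ ⟨x, hx, rfl⟩).imp (hmono.le_iff_le hx ha).1 (hmono.le_iff_le hb hx).1

open Pointwise in
theorem IsGap.of_neg {S : Set ℝ} {a b : ℝ} (h : IsGap (-S) a b) : IsGap S (-b) (-a) :=
  ⟨h.right_mem, h.left_mem, neg_lt_neg h.lt, fun x hx => by
    rcases h.le_or_le (-x) (by simpa using hx) with h | h
    · right; linarith
    · left; linarith⟩

open Pointwise in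
theorem IsThick.neg {S : Set ℝ} {τ : ℝ} (h : IsThick τ S) : IsThick τ (-S) := by
  intro a b c d hab hcd hbc
  rcases h _ _ _ _ hcd.of_neg hab.of_neg (neg_le_neg hbc) with h | h
  · right; linarith
  · left; linarith

/-- The gap lemma for the image of `A` under an increasing bi-Lipschitz map. -/
theorem exists_mem_of_isThick {A B : Set ℝ} {σ τ δ p q c₁ c₂ : ℝ} {h : ℝ → ℝ} (hA : IsCompact A)
    (hB : IsClosed B) (hp : p ∈ A) (hq : q ∈ A) (hpq : A ⊆ Set.Icc p q) (tA : IsThick σ A)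
    (hullA : IsHullThick σ A p q) (hBl : ∀ x, ∃ y ∈ B, y ≤ x) (hBu : ∀ x, ∃ y ∈ B, x ≤ y)
    (tB : IsThick τ B) (hδ : ∀ c d, IsGap B c d → d - c ≤ δ) (hδpq : δ < c₁ * (q - p))
    (hσ : 0 < σ) (hτ : 0 < τ) (hc₁ : 0 < c₁) (hcont : Continuous h)
    (hle : ∀ x y, p ≤ x → x ≤ y → y ≤ q → c₁ * (y - x) ≤ h y - h x ∧ h y - h x ≤ c₂ * (y - x))
    (hστ : c₂ ≤ c₁ * σ * τ) : ∃ x ∈ A, h x ∈ B := by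
  have hpq' : p ≤ q := (hpq hp).2
  have hmono : StrictMonoOn h A := fun x hx y hy hxy => by
    have := (hle x y (hpq hx).1 hxy.le (hpq hy).2).1
    nlinarith [mul_pos hc₁ (sub_pos.2 hxy)]
  -- If p = q then δ < 0, so B has no gaps and contains every point.
  by_cases hlt : p < q
  swap
  · have hpq0 : q = p := le_antisymm (not_lt.1 hlt) hpq'
    obtain ⟨c, hc, hcp⟩ := hBl (h p)
    obtain ⟨d, hd, hdp⟩ := hBu (h p)
    refine ⟨p, hp, ?_⟩
    by_contra hn
    obtain ⟨a, b, hab, -, -⟩ := hB.exists_isGap hn hc hcp hd hdp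
    have := hδ a b hab
    have := hab.lt
    rw [hpq0] at hδpq
    linarith
  have hc₂ : 0 < c₂ := by
    have := hle p q le_rfl hpq' le_rfl
    have h0 : 0 < c₁ * (q - p) := mul_pos hc₁ (sub_pos.2 hlt)
    by_contra hn
    nlinarith
  -- Gaps are stretched by at most c₂ and the distances beside them by at least c₁.
  have hscale : ∀ x y z : ℝ, 0 ≤ x → σ * x ≤ z → y ≤ c₂ * x → c₁ * σ / c₂ * y ≤ c₁ * z := by
    intro x y z hx hxz hyx
    calc c₁ * σ / c₂ * y ≤ c₁ * σ / c₂ * (c₂ * x) := by gcongr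
      _ = c₁ * (σ * x) := by field_simp
      _ ≤ c₁ * z := by gcongr
  suffices hne : (h '' A ∩ B).Nonempty by
    obtain ⟨y, ⟨x, hx, rfl⟩, hy⟩ := hne
    exact ⟨x, hx, hy⟩
  refine inter_nonempty_of_isThick (A := h '' A) (B := B)
    (σ := c₁ * σ / c₂) (τ := τ) (δ := δ) (p := h p) (q := h q)
    (hA.image hcont).isClosed hB ⟨p, hp, rfl⟩ ⟨q, hq, rfl⟩ ?_ ?_ ?_ hBl hBu tB hδ
    (hδpq.trans_le (hle p q le_rfl hpq' le_rfl).1) (by positivity) hτ ?_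
  · rintro _ ⟨x, hx, rfl⟩
    exact ⟨hmono.monotoneOn hp hx (hpq hx).1, hmono.monotoneOn hx hq (hpq hx).2⟩
  · intro u v u' v' huv huv' hbc
    obtain ⟨a, b, hab, rfl, rfl⟩ := huv.exists_of_image hmono
    obtain ⟨c, d, hcd, rfl, rfl⟩ := huv'.exists_of_image hmono
    have hbc : b ≤ c := (hmono.le_iff_le hab.right_mem hcd.left_mem).1 hbc
    have h0 := (hle b c (hpq hab.right_mem).1 hbc (hpq hcd.left_mem).2).1
    have h1 := (hle a b (hpq hab.left_mem).1 hab.lt.le (hpq hab.right_mem).2).2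
    have h2 := (hle c d (hpq hcd.left_mem).1 hcd.lt.le (hpq hcd.right_mem).2).2
    exact (tA a b c d hab hcd hbc).imp
      (fun h => (hscale _ _ _ (sub_nonneg.2 hab.lt.le) h h1).trans h0)
      (fun h => (hscale _ _ _ (sub_nonneg.2 hcd.lt.le) h h2).trans h0)
  · intro u v huv
    obtain ⟨a, b, hab, rfl, rfl⟩ := huv.exists_of_image hmono
    have h1 := (hle a b (hpq hab.left_mem).1 hab.lt.le (hpq hab.right_mem).2).2
    have h2 := (hle p a le_rfl (hpq hab.left_mem).1 (hpq hab.left_mem).2).1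
    have h3 := (hle b q (hpq hab.right_mem).1 (hpq hab.right_mem).2 le_rfl).1
    exact ⟨(hscale _ _ _ (sub_nonneg.2 hab.lt.le) (hullA a b hab).1 h1).trans h2,
      (hscale _ _ _ (sub_nonneg.2 hab.lt.le) (hullA a b hab).2 h1).trans h3⟩
  · rw [div_mul_eq_mul_div, one_le_div hc₂]
    exact hστ

/-! ### Thickness of the Cantor set. -/

theorem one_mem_cantorSet : (1 : ℝ) ∈ cantorSet := by
  simp only [cantorSet, Set.mem_iInter]
  intro n
  induction n with
  | zero => simp
  | succ n ih => exact Or.inr ⟨1, ih, by norm_num⟩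

/-- A gap of the Cantor set is either the middle third or a scaled-down copy of another gap. -/
theorem IsGap.cantorSet_cases {a b : ℝ} (h : IsGap cantorSet a b) :
    (IsGap cantorSet (3 * a) (3 * b) ∧ b ≤ 1 / 3) ∨
    (IsGap cantorSet (3 * a - 2) (3 * b - 2) ∧ 2 / 3 ≤ a) ∨ (a = 1 / 3 ∧ b = 2 / 3) := by
  have hU := cantorSet_eq_union_halves
  have h01 : ∀ x ∈ cantorSet, 0 ≤ x ∧ x ≤ 1 := fun x hx => cantorSet_subset_unitInterval hx
  have hl : ∀ x ∈ cantorSet, x / 3 ∈ cantorSet := fun x hx => by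
    rw [hU]; exact Or.inl ⟨x, hx, rfl⟩
  have hr : ∀ x ∈ cantorSet, (2 + x) / 3 ∈ cantorSet := fun x hx => by
    rw [hU]; exact Or.inr ⟨x, hx, rfl⟩
  have hcase : ∀ x ∈ cantorSet, (3 * x ∈ cantorSet ∧ x ≤ 1 / 3) ∨
      (3 * x - 2 ∈ cantorSet ∧ 2 / 3 ≤ x) := by
    intro x hx
    rw [hU] at hx
    rcases hx with ⟨y, hy, rfl⟩ | ⟨y, hy, rfl⟩
    · refine Or.inl ⟨?_, by simp only; linarith [(h01 y hy).2]⟩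
      convert hy using 1
      ring
    · refine Or.inr ⟨?_, by simp only; linarith [(h01 y hy).1]⟩
      convert hy using 1
      ring
  rcases hcase a h.left_mem with ⟨ha, ha'⟩ | ⟨ha, ha'⟩ <;>
    rcases hcase b h.right_mem with ⟨hb, hb'⟩ | ⟨hb, hb'⟩
  · refine Or.inl ⟨⟨ha, hb, by linarith [h.lt], fun x hx => ?_⟩, hb'⟩
    rcases h.le_or_le _ (hl x hx) with h | h
    · left; linarith
    · right; linarith
  · right; right
    have e1 := h.le_or_le _ (hl 1 one_mem_cantorSet)
    have e2 := h.le_or_le _ (hr 0 zero_mem_cantorSet)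
    norm_num at e1 e2
    constructor
    · rcases e1 with e1 | e1 <;> linarith
    · rcases e2 with e2 | e2 <;> linarith
  · linarith [h.lt]
  · refine Or.inr (Or.inl ⟨⟨ha, hb, by linarith [h.lt], fun x hx => ?_⟩, ha'⟩)
    rcases h.le_or_le _ (hr x hx) with h | h
    · left; linarith
    · right; linarith

/-- Rescaling a gap other than the middle third triples its length, which cannot exceed 1; so
finitely many rescalings reach the middle third. The exponent n bounds their number. -/
theorem isHullThick_cantorSet : IsHullThick 1 cantorSet 0 1 := by
  have key : ∀ n : ℕ, ∀ a b, IsGap cantorSet a b → (1 / 3 : ℝ) ^ n < b - a →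
      b - a ≤ a ∧ b - a ≤ 1 - b := by
    intro n
    induction n with
    | zero =>
      intro a b h hn
      have ha := cantorSet_subset_unitInterval h.left_mem
      have hb := cantorSet_subset_unitInterval h.right_mem
      rw [pow_zero] at hn
      exact absurd hn (by linarith [ha.1, hb.2])
    | succ n ih =>
      intro a b h hn
      rw [pow_succ] at hn
      rcases h.cantorSet_cases with ⟨h', h2⟩ | ⟨h', h2⟩ | ⟨rfl, rfl⟩
      · have := ih _ _ h' (by linarith)
        constructor <;> linarith
      · have := ih _ _ h' (by linarith)
        constructor <;> linarith
      · norm_num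
  intro a b h
  obtain ⟨n, hn⟩ := exists_pow_lt_of_lt_one (sub_pos.2 h.lt) (by norm_num : (1 / 3 : ℝ) < 1)
  have := key n a b h hn
  constructor <;> linarith

/-- Two gaps in the same third are rescaled together. Otherwise one of them lies in an outer third,
and its distance to the inner end of that third is bounded by hull thickness. -/
theorem isThick_cantorSet : IsThick 1 cantorSet := by
  have key : ∀ n : ℕ, ∀ a b c d, IsGap cantorSet a b → IsGap cantorSet c d → b ≤ c →
      (1 / 3 : ℝ) ^ n < b - a → b - a ≤ c - b ∨ d - c ≤ c - b := by
    intro n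
    induction n with
    | zero =>
      intro a b c d h _ _ hn
      have ha := cantorSet_subset_unitInterval h.left_mem
      have hb := cantorSet_subset_unitInterval h.right_mem
      rw [pow_zero] at hn
      exact absurd hn (by linarith [ha.1, hb.2])
    | succ n ih =>
      intro a b c d h h' hbc hn
      rw [pow_succ] at hn
      have e := h.lt
      have e' := h'.lt
      rcases h.cantorSet_cases with ⟨g, h2⟩ | ⟨g, h2⟩ | ⟨rfl, rfl⟩ <;>
        rcases h'.cantorSet_cases with ⟨g', h2'⟩ | ⟨g', h2'⟩ | ⟨rfl, rfl⟩
      · rcases ih _ _ _ _ g g' (by linarith) (by linarith) with h | h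
        · left; linarith
        · right; linarith
      · have := isHullThick_cantorSet _ _ g
        left; linarith
      · have := isHullThick_cantorSet _ _ g
        left; linarith
      · linarith
      · rcases ih _ _ _ _ g g' (by linarith) (by linarith) with h | h
        · left; linarith
        · right; linarith
      · linarith
      · linarith
      · have := isHullThick_cantorSet _ _ g'
        right; linarith
      · linarith
  intro a b c d h h' hbc
  obtain ⟨n, hn⟩ := exists_pow_lt_of_lt_one (sub_pos.2 h.lt) (by norm_num : (1 / 3 : ℝ) < 1)
  simpa using key n a b c d h h' hbc hn

/-! ### Continued fractions with digits at most 6. -/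

noncomputable section

/-- The value of the periodic continued fraction `[0, 1, 6, 1, 6, …]`. -/
def cfHi : ℝ := √15 - 3

/-- The value of the periodic continued fraction `[0, 6, 1, 6, 1, …]`. -/
def cfLo : ℝ := cfHi / 6

/-- The numbers `[0, a 0, a 1, …]` with digits at most `6`, described by the orbit
`y n = [0, a n, a (n + 1), …]`. -/
def cfFrac : Set ℝ := {x | ∃ (y : ℕ → ℝ) (a : ℕ → ℕ), y 0 = x ∧
  ∀ n, y n ∈ Set.Icc cfLo cfHi ∧ (1 ≤ a n ∧ a n ≤ 6) ∧ y n * (a n + y (n + 1)) = 1}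

/-- The integer translates of `cfFrac`. -/
def cfSet : Set ℝ := {x | ∃ k : ℤ, x - k ∈ cfFrac}

end

theorem cfHi_sq : cfHi * (6 + cfHi) = 6 := by
  have : √15 * √15 = 15 := Real.mul_self_sqrt (by norm_num)
  unfold cfHi
  linarith

theorem cfHi_gt : 0.8729 < cfHi := by
  have : (3.8729 : ℝ) < √15 := Real.lt_sqrt_of_sq_lt (by norm_num)
  unfold cfHi
  linarith

theorem cfHi_lt : cfHi < 0.873 := by
  have : √15 < 3.873 := (Real.sqrt_lt' (by norm_num)).2 (by norm_num)
  unfold cfHi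
  linarith

theorem six_mul_cfLo : 6 * cfLo = cfHi := by unfold cfLo; ring

theorem cfLo_gt : 0.1454 < cfLo := by linarith [six_mul_cfLo, cfHi_gt]

theorem cfLo_lt : cfLo < 0.1455 := by linarith [six_mul_cfLo, cfHi_lt]

theorem cfHi_mul : cfHi * (1 + cfLo) = 1 := by
  unfold cfLo
  linarith [cfHi_sq]

theorem cfLo_mul : cfLo * (6 + cfHi) = 1 := by
  unfold cfLo
  linarith [cfHi_sq]

theorem cfFrac_subset : cfFrac ⊆ Set.Icc cfLo cfHi := by
  rintro _ ⟨y, a, rfl, h⟩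
  exact (h 0).1

theorem cfFrac_step {x : ℝ} (hx : x ∈ cfFrac) :
    ∃ k : ℕ, 1 ≤ k ∧ k ≤ 6 ∧ ∃ z ∈ cfFrac, x * (k + z) = 1 := by
  obtain ⟨y, a, rfl, h⟩ := hx
  exact ⟨a 0, (h 0).2.1.1, (h 0).2.1.2, y 1, ⟨fun n => y (n + 1), fun n => a (n + 1), rfl,
    fun n => h (n + 1)⟩, (h 0).2.2⟩

theorem mem_Icc_of_mul_eq_one {x z k : ℝ} (hz : z ∈ Set.Icc cfLo cfHi) (hk : 1 ≤ k) (hk' : k ≤ 6)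
    (h : x * (k + z) = 1) : x ∈ Set.Icc cfLo cfHi := by
  have h1 := hz.1
  have h2 := hz.2
  have h3 := cfLo_gt
  have h4 := cfHi_gt
  have hx : x = 1 / (k + z) := by rw [eq_div_iff (by linarith), h]
  have e1 : cfLo = 1 / (6 + cfHi) := by rw [eq_div_iff (by linarith), cfLo_mul]
  have e2 : cfHi = 1 / (1 + cfLo) := by rw [eq_div_iff (by linarith), cfHi_mul]
  constructor
  · rw [e1, hx]
    exact one_div_le_one_div_of_le (by linarith) (by linarith)
  · rw [e2, hx]
    exact one_div_le_one_div_of_le (by linarith) (by linarith)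

theorem mem_cfFrac_of_mul_eq_one {x z : ℝ} {k : ℕ} (hz : z ∈ cfFrac) (hk : 1 ≤ k) (hk' : k ≤ 6)
    (h : x * (k + z) = 1) : x ∈ cfFrac := by
  have hx : x ∈ Set.Icc cfLo cfHi := mem_Icc_of_mul_eq_one (cfFrac_subset hz)
    (by exact_mod_cast hk) (by exact_mod_cast hk') h
  obtain ⟨y, a, rfl, H⟩ := hz
  refine ⟨fun n => Nat.casesOn n x y, fun n => Nat.casesOn n k a, rfl, fun n => ?_⟩
  cases n with
  | zero => exact ⟨hx, ⟨hk, hk'⟩, h⟩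
  | succ n => exact H n

/-- Coinduction principle: iterating the choice of z produces the orbit required by `cfFrac`. -/
theorem subset_cfFrac {S : Set ℝ} (hS : S ⊆ Set.Icc cfLo cfHi)
    (h : ∀ x ∈ S, ∃ k : ℕ, 1 ≤ k ∧ k ≤ 6 ∧ ∃ z ∈ S, x * (k + z) = 1) : S ⊆ cfFrac := by
  choose! k h1 h6 z hz hk using h
  intro x hx
  have hmem : ∀ n, z^[n] x ∈ S := fun n => by
    induction n with
    | zero => exact hx
    | succ n ih => rw [Function.iterate_succ_apply']; exact hz _ ih
  refine ⟨fun n => z^[n] x, fun n => k (z^[n] x), rfl, fun n => ⟨hS (hmem n),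
    ⟨h1 _ (hmem n), h6 _ (hmem n)⟩, ?_⟩⟩
  simp only [Function.iterate_succ_apply']
  exact hk _ (hmem n)

theorem pair_subset_cfFrac : {cfLo, cfHi} ⊆ cfFrac := by
  have hlh : cfLo ≤ cfHi := by linarith [cfLo_lt, cfHi_gt]
  refine subset_cfFrac ?_ ?_
  · rintro x (rfl | rfl)
    exacts [⟨le_rfl, hlh⟩, ⟨hlh, le_rfl⟩]
  · rintro x (rfl | rfl)
    · exact ⟨6, by norm_num, le_rfl, cfHi, Or.inr rfl, by exact_mod_cast cfLo_mul⟩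
    · exact ⟨1, le_rfl, by norm_num, cfLo, Or.inl rfl, by exact_mod_cast cfHi_mul⟩

theorem cfLo_mem : cfLo ∈ cfFrac := pair_subset_cfFrac (Or.inl rfl)

theorem cfHi_mem : cfHi ∈ cfFrac := pair_subset_cfFrac (Or.inr rfl)

theorem isClosed_cfFrac : IsClosed cfFrac := by
  have hsub : closure cfFrac ⊆ Set.Icc cfLo cfHi := closure_minimal cfFrac_subset isClosed_Icc
  have hcomp : IsCompact (closure cfFrac) := isCompact_Icc.of_isClosed_subset isClosed_closure hsub
  refine isClosed_of_closure_subset (subset_cfFrac hsub ?_)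
  -- The six branches z ↦ 1 / (k + z) map the closure onto a closed set containing `cfFrac`, hence
  -- the closure; coinduction then applies to the closure itself.
  let T : Set ℝ := ⋃ k ∈ Finset.Icc 1 6, (fun z : ℝ => 1 / ((k : ℕ) + z)) '' closure cfFrac
  have hT : IsClosed T := by
    refine isClosed_biUnion_finset fun k _ => (hcomp.image_of_continuousOn ?_).isClosed
    refine continuousOn_const.div (by fun_prop) fun z hz => ?_
    exact (add_pos_of_nonneg_of_pos k.cast_nonneg (by linarith [(hsub hz).1, cfLo_gt])).ne'
  have hsubT : closure cfFrac ⊆ T := by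
    refine closure_minimal (fun x hx => ?_) hT
    obtain ⟨k, h1, h6, z, hz, h⟩ := cfFrac_step hx
    refine Set.mem_biUnion (Finset.mem_Icc.2 ⟨h1, h6⟩) ⟨z, subset_closure hz, ?_⟩
    simp only
    rw [div_eq_iff (right_ne_zero_of_mul_eq_one h), h]
  intro x hx
  obtain ⟨k, hk, z, hz, rfl⟩ := Set.mem_iUnion₂.1 (hsubT hx)
  refine ⟨k, (Finset.mem_Icc.1 hk).1, (Finset.mem_Icc.1 hk).2, z, hz, ?_⟩
  exact one_div_mul_cancel
    (add_pos_of_nonneg_of_pos k.cast_nonneg (by linarith [(hsub hz).1, cfLo_gt])).ne'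

theorem isCompact_cfFrac : IsCompact cfFrac :=
  isCompact_Icc.of_isClosed_subset isClosed_cfFrac cfFrac_subset

open Pointwise in
theorem isClosed_cfSet : IsClosed cfSet := by
  have : cfSet = Set.range ((↑) : ℤ → ℝ) + cfFrac := by
    ext x
    rw [Set.mem_add]
    constructor
    · rintro ⟨k, hk⟩
      exact ⟨k, ⟨k, rfl⟩, _, hk, by ring⟩
    · rintro ⟨_, ⟨k, rfl⟩, y, hy, rfl⟩
      exact ⟨k, by simpa using hy⟩
  rw [this]
  exact Int.isClosedEmbedding_coe_real.isClosed_range.add_right_of_isCompact isCompact_cfFrac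

theorem cfFrac_subset_cfSet : cfFrac ⊆ cfSet := fun x hx => ⟨0, by simpa using hx⟩

theorem add_int_mem_cfSet {x : ℝ} (hx : x ∈ cfSet) (k : ℤ) : x + k ∈ cfSet := by
  obtain ⟨j, hj⟩ := hx
  refine ⟨j + k, ?_⟩
  push_cast
  rwa [add_sub_add_right_eq_sub]

theorem mem_cfFrac_of_mem_cfSet {x : ℝ} (hx : x ∈ cfSet) (h1 : cfLo ≤ x) (h2 : x ≤ cfHi) :
    x ∈ cfFrac := by
  obtain ⟨k, hk⟩ := hx
  have h := cfFrac_subset hk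
  have := cfLo_gt
  have := cfHi_lt
  have h3 : (k : ℝ) < 1 := by linarith [h.1]
  have h4 : (-1 : ℝ) < k := by linarith [h.2]
  have h5 : k = 0 := by
    have : k < 1 := by exact_mod_cast h3
    have : -1 < k := by exact_mod_cast h4
    omega
  simpa [h5] using hk

theorem inv_mem_cfSet {x : ℝ} (hx : x ∈ cfSet) (h1 : cfLo ≤ x) (h2 : x ≤ cfHi) : x⁻¹ ∈ cfSet := by
  obtain ⟨k, -, -, z, hz, h⟩ := cfFrac_step (mem_cfFrac_of_mem_cfSet hx h1 h2)
  rw [inv_eq_of_mul_eq_one_right h]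
  refine ⟨k, ?_⟩
  simpa using hz

theorem inv_mem_cfSet' {x : ℝ} (hx : x ∈ cfSet) (h1 : 1 + cfLo ≤ x) (h2 : x ≤ 6 + cfHi) :
    x⁻¹ ∈ cfSet := by
  obtain ⟨k, hk⟩ := hx
  have h := cfFrac_subset hk
  have := cfLo_gt
  have := cfHi_lt
  have h3 : (k : ℝ) < 7 := by linarith [h.1]
  have h4 : (0 : ℝ) < k := by linarith [h.2]
  have h5 : k < 7 := by exact_mod_cast h3
  have h6 : 0 < k := by exact_mod_cast h4
  lift k to ℕ using h6.le
  refine cfFrac_subset_cfSet (mem_cfFrac_of_mul_eq_one hk (k := k) (by omega) (by omega) ?_)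
  push_cast
  rw [add_sub_cancel]
  exact inv_mul_cancel₀ (by linarith)

theorem IsGap.cfSet_cases {a b : ℝ} (h : IsGap cfSet a b) :
    ∃ k : ℤ, (k + cfLo ≤ a ∧ b ≤ k + cfHi) ∨ (a = k + cfHi ∧ b = k + 1 + cfLo) := by
  obtain ⟨k, hk⟩ := h.left_mem
  obtain ⟨j, hj⟩ := h.right_mem
  have h1 := cfFrac_subset hk
  have h2 := cfFrac_subset hj
  have e1 := cfLo_gt
  have e2 := cfHi_lt
  have hlt := h.lt
  refine ⟨k, ?_⟩
  by_cases hb : b ≤ k + cfHi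
  · exact Or.inl ⟨by linarith [h1.1], hb⟩
  · right
    have hkj : (k : ℝ) + 1 ≤ j := by
      have : (k : ℝ) < j := by linarith [h2.2]
      exact_mod_cast this
    have m1 := h.le_or_le (k + cfHi) ⟨k, by simpa using cfHi_mem⟩
    have m2 := h.le_or_le (k + 1 + cfLo) ⟨k + 1, by simpa using cfLo_mem⟩
    constructor
    · rcases m1 with m1 | m1 <;> linarith [h1.2]
    · rcases m2 with m2 | m2 <;> linarith [h2.1, h1.2]

theorem IsGap.add_int {a b : ℝ} (h : IsGap cfSet a b) (k : ℤ) : IsGap cfSet (a + k) (b + k) := by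
  refine ⟨add_int_mem_cfSet h.left_mem k, add_int_mem_cfSet h.right_mem k, by linarith [h.lt],
    fun x hx => ?_⟩
  have := add_int_mem_cfSet hx (-k)
  push_cast at this
  rcases h.le_or_le _ this with h | h
  · left; linarith
  · right; linarith

theorem one_add_cfLo_le_inv {x : ℝ} (h1 : cfLo ≤ x) (h2 : x ≤ cfHi) : 1 + cfLo ≤ x⁻¹ := by
  rw [← inv_eq_of_mul_eq_one_right cfHi_mul]
  exact inv_anti₀ (by linarith [cfLo_gt]) h2

theorem inv_le_six_add_cfHi {x : ℝ} (h1 : cfLo ≤ x) : x⁻¹ ≤ 6 + cfHi := by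
  rw [← inv_eq_of_mul_eq_one_right cfLo_mul]
  exact inv_anti₀ (by linarith [cfLo_gt]) h1

/-- Inversion is an order-reversing bijection between the parts of `cfSet` in [cfLo, cfHi] and in [1
+ cfLo, 6 + cfHi]. -/
theorem IsGap.inv {a b : ℝ} (h : IsGap cfSet a b) (ha : cfLo ≤ a) (hb : b ≤ cfHi) :
    IsGap cfSet b⁻¹ a⁻¹ := by
  have hlo := cfLo_gt
  have hlt := h.lt
  have ha0 : 0 < a := by linarith
  have hb0 : 0 < b := by linarith
  refine ⟨inv_mem_cfSet h.right_mem (by linarith) hb, inv_mem_cfSet h.left_mem ha (by linarith),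
    inv_strictAnti₀ ha0 hlt, fun x hx => ?_⟩
  by_contra! hcon
  have h1 := one_add_cfLo_le_inv (ha.trans hlt.le) hb
  have h2 := inv_le_six_add_cfHi ha
  have hx0 : 0 < x := (inv_pos.2 hb0).trans hcon.1
  rcases h.le_or_le x⁻¹ (inv_mem_cfSet' hx (by linarith) (by linarith)) with h | h
  · exact absurd (inv_anti₀ (inv_pos.2 hx0) h) (by rw [inv_inv]; exact not_le.2 hcon.2)
  · exact absurd (inv_anti₀ hb0 h) (by rw [inv_inv]; exact not_le.2 hcon.1)

theorem exists_mem_cfSet_le (x : ℝ) : ∃ y ∈ cfSet, y ≤ x := by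
  refine ⟨cfLo + (⌊x⌋ - 1 : ℤ), add_int_mem_cfSet (cfFrac_subset_cfSet cfLo_mem) _, ?_⟩
  push_cast
  linarith [Int.floor_le x, cfLo_lt]

theorem exists_mem_cfSet_ge (x : ℝ) : ∃ y ∈ cfSet, x ≤ y := by
  refine ⟨cfLo + (⌊x⌋ + 1 : ℤ), add_int_mem_cfSet (cfFrac_subset_cfSet cfLo_mem) _, ?_⟩
  push_cast
  linarith [Int.lt_floor_add_one x, cfLo_gt]

/-! ### Convergence of the finite continued fractions. -/

theorem convs'Aux_ofStream (a : ℕ → ℕ) (n : ℕ) :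
    GenContFract.convs'Aux (Stream'.Seq.ofStream fun n => (⟨1, (a n : ℝ)⟩ : GenContFract.Pair ℝ))
      (n + 1) = 1 / (a 0 + GenContFract.convs'Aux
        (Stream'.Seq.ofStream fun n => (⟨1, (a (n + 1) : ℝ)⟩ : GenContFract.Pair ℝ)) n) := by
  rw [GenContFract.convs'Aux_succ_some (p := ⟨1, (a 0 : ℝ)⟩) rfl]
  rfl

/-- Prepending a digit multiplies the error by y 0 / (a 0 + c), which is at most `cfHi` because a 0
+ c ≥ 1. -/
theorem abs_convs'Aux_sub_le (n : ℕ) : ∀ (y : ℕ → ℝ) (a : ℕ → ℕ), (∀ n, y n ∈ Set.Icc cfLo cfHi ∧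
    (1 ≤ a n ∧ a n ≤ 6) ∧ y n * (a n + y (n + 1)) = 1) →
    0 ≤ GenContFract.convs'Aux
      (Stream'.Seq.ofStream fun n => (⟨1, (a n : ℝ)⟩ : GenContFract.Pair ℝ)) n ∧
    |GenContFract.convs'Aux
      (Stream'.Seq.ofStream fun n => (⟨1, (a n : ℝ)⟩ : GenContFract.Pair ℝ)) n - y 0| ≤
      cfHi ^ n := by
  have hlo := cfLo_gt
  have hhi := cfHi_lt
  induction n with
  | zero =>
    intro y a h
    have := (h 0).1
    simp only [GenContFract.convs'Aux, pow_zero, zero_sub, abs_neg, le_refl, true_and]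
    rw [abs_of_pos (by linarith [this.1])]
    linarith [this.2]
  | succ n ih =>
    intro y a h
    obtain ⟨h0, h1⟩ := ih (fun n => y (n + 1)) (fun n => a (n + 1)) fun n => h (n + 1)
    rw [convs'Aux_ofStream]
    set c := GenContFract.convs'Aux
        (Stream'.Seq.ofStream fun n => (⟨1, (a (n + 1) : ℝ)⟩ : GenContFract.Pair ℝ)) n
    replace h1 : |c - y 1| ≤ cfHi ^ n := h1
    obtain ⟨hy, ha, hya⟩ := h 0
    rw [zero_add] at hya
    have ha1 : (1 : ℝ) ≤ a 0 := by exact_mod_cast ha.1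
    have hpos : 0 < (a 0 : ℝ) + c := by linarith
    refine ⟨by positivity, ?_⟩
    have hd : 1 / (a 0 + c) - y 0 = y 0 * ((y 1 - c) / (a 0 + c)) := by
      rw [mul_div_assoc', eq_div_iff hpos.ne', sub_mul, div_mul_cancel₀ _ hpos.ne']
      linarith
    have hy0 : 0 < y 0 := by linarith [hy.1]
    rw [hd, abs_mul, abs_div, abs_of_pos hpos, abs_of_pos hy0, pow_succ, mul_comm, abs_sub_comm]
    refine mul_le_mul ((div_le_self (abs_nonneg _) (by linarith)).trans h1) hy.2 hy0.le ?_
    exact pow_nonneg (by linarith [cfHi_gt]) _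

theorem cfSet_subset_contFractSet {m : ℕ} (hm : 6 ≤ m) : cfSet ⊆ contFractSet m := by
  rintro x ⟨t, y, a, hy, h⟩
  refine ⟨t, a, fun i => ⟨(h i).2.1.1, (h i).2.1.2.trans hm⟩, ?_⟩
  have hp : Tendsto (fun n : ℕ => cfHi ^ n) atTop (𝓝 0) :=
    tendsto_pow_atTop_nhds_zero_of_lt_one (by linarith [cfHi_gt]) (by linarith [cfHi_lt])
  have hc := squeeze_zero_norm (f := fun n => GenContFract.convs'Aux
    (Stream'.Seq.ofStream fun n => (⟨1, (a n : ℝ)⟩ : GenContFract.Pair ℝ)) n - y 0) (fun n => (abs_convs'Aux_sub_le n y a h).2) hp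
  have := (hc.add_const (y 0)).const_add (t : ℝ)
  rw [zero_add, hy, add_sub_cancel] at this
  refine this.congr fun n => ?_
  rw [sub_add_cancel]
  rfl

/-! ### Thickness of the continued fraction set. -/

/-- Lets the far endpoint e of a bridge move outwards. Both sides are affine in e, and the
hypothesis at e forces the slopes to satisfy X p ≤ W. -/
theorem mul_affine_mono {X W p q A e e' : ℝ} (hX : 0 ≤ X) (hW : 0 ≤ W) (hq : 0 ≤ q) (hA : 0 ≤ A)
    (he : 0 < e) (hee : e ≤ e') (h : X * (p * e + q) ≤ (e - A) * W) :
    X * (p * e' + q) ≤ (e' - A) * W := by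
  have h1 : X * p ≤ W := by
    have h2 : 0 ≤ X * q := mul_nonneg hX hq
    have h3 : 0 ≤ A * W := mul_nonneg hA hW
    have h4 : X * p * e ≤ W * e := by linarith
    exact le_of_mul_le_mul_right h4 he
  nlinarith [mul_le_mul_of_nonneg_right h1 (sub_nonneg.2 hee)]

/-- Inversion divides the length by a b ≤ 4/5, so gaps grow geometrically and the inductions on n
terminate. -/
theorem pow_lt_inv_sub_inv {a b : ℝ} {n : ℕ} (ha : cfLo ≤ a) (hab : a < b) (hb : b ≤ cfHi)
    (hn : (4 / 5 : ℝ) ^ (n + 1) < b - a) : (4 / 5 : ℝ) ^ n < a⁻¹ - b⁻¹ := by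
  have hlo := cfLo_gt
  have hhi := cfHi_lt
  have ha0 : 0 < a := by linarith
  have hb0 : 0 < b := by linarith
  have h1 : a * b ≤ 4 / 5 := by nlinarith
  rw [inv_sub_inv ha0.ne' hb0.ne', lt_div_iff₀ (mul_pos ha0 hb0)]
  refine lt_of_le_of_lt ?_ hn
  rw [pow_succ]
  gcongr

/-- The central gap between two integer translates compared with the part of `cfSet` beyond. -/
theorem central_gap_le {k : ℝ} (h1 : 1 ≤ k) (h5 : k ≤ 5) :
    2.1 * (1 + cfLo - cfHi) * (6 + cfHi) ≤ (5 - k + cfHi - cfLo) * (k + cfHi) := by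
  have hs := six_mul_cfLo
  have h3 := cfHi_gt
  have h4 := cfHi_lt
  -- After rounding, the left side is concave in k, so k = 1 and k = 5 are the extreme cases.
  have h6 : 3.94 ≤ (5 - k + cfHi - cfLo) * (k + cfHi) := by
    have e1 : 0.727 ≤ cfHi - cfLo := by linarith
    have e2 : (5 - k + 0.727) * (k + 0.8729) ≤ (5 - k + cfHi - cfLo) * (k + cfHi) := by
      apply mul_le_mul <;> linarith
    nlinarith [mul_nonneg (sub_nonneg.2 h1) (sub_nonneg.2 h5)]
  have h7 : 1 + cfLo - cfHi ≤ 0.2726 := by linarith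
  have h8 : (1 + cfLo - cfHi) * (6 + cfHi) ≤ 0.2726 * 6.873 := by
    apply mul_le_mul <;> linarith
  linarith

/-- Hull thickness of the image under a Möbius map with denominator p + q x, cleared of
denominators. Under x = 1/X the weight becomes x (p X + q), so the claim turns into one about the
inverted gap in [1 + cfLo, 6 + cfHi]. -/
theorem hull_cfSet_aux (n : ℕ) : ∀ a b p q : ℝ, IsGap cfSet a b → cfLo ≤ a → b ≤ cfHi →
    (4 / 5 : ℝ) ^ n < b - a → 0 ≤ q → q ≤ p → 0 < p →
    2.1 * (b - a) * (p + q * cfHi) ≤ (cfHi - b) * (p + q * a) ∧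
    2.1 * (b - a) * (p + q * cfLo) ≤ (a - cfLo) * (p + q * b) := by
  have hlo := cfLo_gt
  have hlo' := cfLo_lt
  have hhi := cfHi_lt
  have hhi' := cfHi_gt
  induction n with
  | zero =>
    intro a b p q h ha hb hn
    rw [pow_zero] at hn
    linarith
  | succ n ih =>
    intro a b p q h ha hb hn hq hqp hp
    have hlt := h.lt
    have hg := h.inv ha hb
    have hn' := pow_lt_inv_sub_inv ha hlt hb hn
    have hB1 := one_add_cfLo_le_inv (ha.trans hlt.le) hb
    have hA6 := inv_le_six_add_cfHi ha
    have ha0 : 0 < a := by linarith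
    have hb0 : 0 < b := by linarith
    have haA : a * a⁻¹ = 1 := mul_inv_cancel₀ ha0.ne'
    have hbB : b * b⁻¹ = 1 := mul_inv_cancel₀ hb0.ne'
    have hAB := hg.lt
    generalize a⁻¹ = A at *
    generalize b⁻¹ = B at *
    have key : 2.1 * (A - B) * (p * (1 + cfLo) + q) ≤ (B - (1 + cfLo)) * (p * A + q) ∧
        2.1 * (A - B) * (p * (6 + cfHi) + q) ≤ (6 + cfHi - A) * (p * B + q) := by
      have hX : 0 ≤ 2.1 * (A - B) := by linarith
      have hpB : 0 ≤ p * B + q := by nlinarith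
      have hpA : 0 ≤ p * A + q := by nlinarith
      obtain ⟨k, ⟨hk1, hk2⟩ | ⟨rfl, rfl⟩⟩ := hg.cfSet_cases
      · have hk0 : (1 : ℝ) ≤ k := by
          have : (0 : ℝ) < k := by linarith
          exact_mod_cast this
        have hk6 : (k : ℝ) ≤ 6 := by
          have : (k : ℝ) < 7 := by linarith
          have : k < 7 := by exact_mod_cast this
          have : k ≤ 6 := by omega
          exact_mod_cast this
        have hg' := hg.add_int (-k)
        -- Writing X = k + x gives p X + q = (p k + q) + p x, and p ≤ p k + q since k ≥ 1.
        have := ih _ _ (p * k + q) p hg' (by push_cast; linarith) (by push_cast; linarith)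
          (by push_cast; linarith) hp.le (by nlinarith) (by nlinarith)
        push_cast at this
        obtain ⟨i1, i2⟩ := this
        constructor
        · calc 2.1 * (A - B) * (p * (1 + cfLo) + q)
              ≤ 2.1 * (A - B) * (p * (k + cfLo) + q) := by gcongr
            _ ≤ (B - (k + cfLo)) * (p * A + q) := by linarith
            _ ≤ (B - (1 + cfLo)) * (p * A + q) := by gcongr
        · exact mul_affine_mono (e := k + cfHi) hX hpB hq (by linarith) (by linarith)
            (by linarith) (by linarith)
      · have hk0 : (1 : ℝ) ≤ k := by
          have : (0 : ℝ) < k := by linarith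
          exact_mod_cast this
        have hk5 : (k : ℝ) ≤ 5 := by
          have : (k : ℝ) < 6 := by linarith
          have : k < 6 := by exact_mod_cast this
          have : k ≤ 5 := by omega
          exact_mod_cast this
        constructor
        · apply mul_le_mul <;> nlinarith
        · have e1 := mul_le_mul_of_nonneg_left (central_gap_le hk0 hk5) hp.le
          have e2 : 2.1 * (1 + cfLo - cfHi) ≤ 5 - k + cfHi - cfLo := by linarith
          have e3 := mul_le_mul_of_nonneg_left e2 hq
          linarith
    have e1 : b - a = (A - B) * (a * b) := by linear_combination a * hbB - b * haA
    have e2 : p + q * cfHi = cfHi * (p * (1 + cfLo) + q) := by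
      linear_combination (-p) * cfHi_mul
    have e3 : p + q * cfLo = cfLo * (p * (6 + cfHi) + q) := by
      linear_combination (-p) * cfLo_mul
    have e4 : p + q * a = a * (p * A + q) := by linear_combination (-p) * haA
    have e5 : p + q * b = b * (p * B + q) := by linear_combination (-p) * hbB
    have e6 : cfHi - b = (B - (1 + cfLo)) * (cfHi * b) := by
      linear_combination (-cfHi) * hbB + b * cfHi_mul
    have e7 : a - cfLo = (6 + cfHi - A) * (cfLo * a) := by
      linear_combination cfLo * haA - a * cfLo_mul
    constructor
    · rw [e1, e2, e4, e6]
      have := mul_le_mul_of_nonneg_left key.1 (by positivity : 0 ≤ a * b * cfHi)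
      linarith
    · rw [e1, e3, e5, e7]
      have := mul_le_mul_of_nonneg_left key.2 (by positivity : 0 ≤ a * b * cfLo)
      linarith

theorem hull_cfSet {a b p q : ℝ} {k : ℤ} (h : IsGap cfSet a b) (ha : k + cfLo ≤ a)
    (hb : b ≤ k + cfHi) (hq : 0 ≤ q) (hqp : q ≤ p + q * k) (hp : 0 < p + q * k) :
    2.1 * (b - a) * (p + q * (k + cfHi)) ≤ (k + cfHi - b) * (p + q * a) ∧
    2.1 * (b - a) * (p + q * (k + cfLo)) ≤ (a - (k + cfLo)) * (p + q * b) := by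
  obtain ⟨n, hn⟩ := exists_pow_lt_of_lt_one (sub_pos.2 h.lt) (by norm_num : (4 / 5 : ℝ) < 1)
  have := hull_cfSet_aux n _ _ (p + q * k) q (h.add_int (-k)) (by push_cast; linarith)
    (by push_cast; linarith) (by push_cast; linarith) hq hqp hp
  push_cast at this
  constructor <;> linarith

/-- Reduction of the comparison of two gaps to gaps in the same integer translate. -/
theorem pair_cfSet_of_same {a b c d p q : ℝ} {K : ℤ} (h : IsGap cfSet a b) (h' : IsGap cfSet c d)
    (hbc : b ≤ c) (hq : 0 ≤ q) (hKa : K + cfLo ≤ a) (hqp : q ≤ p + q * K) (hp : 0 < p + q * K)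
    (hsame : ∀ k : ℤ, K ≤ k → k + cfLo ≤ a → d ≤ k + cfHi →
      2.1 * (b - a) * (p + q * c) ≤ (c - b) * (p + q * a) ∨
      2.1 * (d - c) * (p + q * b) ≤ (c - b) * (p + q * d)) :
    2.1 * (b - a) * (p + q * c) ≤ (c - b) * (p + q * a) ∨
      2.1 * (d - c) * (p + q * b) ≤ (c - b) * (p + q * d) := by
  have hlo := cfLo_gt
  have hlo' := cfLo_lt
  have hhi := cfHi_lt
  have hhi' := cfHi_gt
  have hab := h.lt
  have hcd := h'.lt
  have hK : ∀ {k : ℤ}, K ≤ k → q ≤ p + q * k ∧ 0 < p + q * k := fun {k} hk => by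
    have : (K : ℝ) ≤ k := by exact_mod_cast hk
    have := mul_le_mul_of_nonneg_left this hq
    constructor <;> linarith
  have hw : ∀ {x : ℝ}, K ≤ x → 0 ≤ p + q * x := fun {x} hx => by
    have := mul_le_mul_of_nonneg_left hx hq
    linarith
  have hleft : ∀ j : ℤ, j + cfLo ≤ a → b ≤ j + cfHi → j + cfHi ≤ c →
      2.1 * (b - a) * (p + q * c) ≤ (c - b) * (p + q * a) := by
    intro j hj1 hj2 hj3
    have hKj : K ≤ j := by
      have : (K : ℝ) < j + 1 := by linarith
      have : K < j + 1 := by exact_mod_cast this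
      omega
    have h1 := (hull_cfSet h hj1 hj2 hq (hK hKj).1 (hK hKj).2).1
    have hwa := hw (x := a) (by linarith)
    have hwb := hw (x := b) (by linarith)
    -- Coordinates are measured from K, where the constant term p + q K is positive.
    have := mul_affine_mono (X := 2.1 * (b - a)) (W := p + q * a) (p := q) (q := p + q * K)
      (A := b - K) (e := j + cfHi - K) (e' := c - K) (by linarith) hwa hp.le (by linarith)
      (by linarith) (by linarith) (by linarith)
    linarith
  have hright : ∀ k : ℤ, k + cfLo ≤ c → d ≤ k + cfHi → b ≤ k + cfLo →
      2.1 * (d - c) * (p + q * b) ≤ (c - b) * (p + q * d) := by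
    intro k hk1 hk2 hk3
    have hKk : K ≤ k := by
      have : (K : ℝ) < k + 1 := by linarith
      have : K < k + 1 := by exact_mod_cast this
      omega
    have h1 := (hull_cfSet h' hk1 hk2 hq (hK hKk).1 (hK hKk).2).2
    have hwd := hw (x := d) (by linarith)
    calc 2.1 * (d - c) * (p + q * b) ≤ 2.1 * (d - c) * (p + q * (k + cfLo)) := by
          have : 0 ≤ 2.1 * (d - c) := by linarith
          gcongr
      _ ≤ (c - (k + cfLo)) * (p + q * d) := h1
      _ ≤ (c - b) * (p + q * d) := by gcongr
  obtain ⟨j, hj⟩ := h.cfSet_cases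
  obtain ⟨k, hk⟩ := h'.cfSet_cases
  rcases hj with ⟨hj1, hj2⟩ | ⟨hj1, hj2⟩ <;> rcases hk with ⟨hk1, hk2⟩ | ⟨hk1, hk2⟩
  · have hjk : j ≤ k := by
      have : (j : ℝ) < k + 1 := by linarith
      have : j < k + 1 := by exact_mod_cast this
      omega
    rcases hjk.eq_or_lt with rfl | hlt
    · refine hsame j ?_ hj1 hk2
      have : (K : ℝ) < j + 1 := by linarith
      have : K < j + 1 := by exact_mod_cast this
      omega
    · have : (j : ℝ) + 1 ≤ k := by exact_mod_cast hlt
      exact Or.inl (hleft j hj1 hj2 (by linarith))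
  · have hjk : j ≤ k := by
      have : (j : ℝ) < k + 1 := by linarith
      have : j < k + 1 := by exact_mod_cast this
      omega
    have : (j : ℝ) ≤ k := by exact_mod_cast hjk
    exact Or.inl (hleft j hj1 hj2 (by linarith))
  · have hjk : j + 1 ≤ k := by
      have : (j : ℝ) < k := by linarith
      exact_mod_cast this
    have : (j : ℝ) + 1 ≤ k := by exact_mod_cast hjk
    exact Or.inr (hright k hk1 hk2 (by linarith))
  · have hjk : j + 1 ≤ k := by
      have : (j : ℝ) < k := by linarith
      exact_mod_cast this
    have : (j : ℝ) + 1 ≤ k := by exact_mod_cast hjk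
    -- Between two central gaps lies a whole translate, of length cfHi - cfLo > 2.1 (1 + cfLo -
    -- cfHi).
    right
    have hwb := hw (x := b) (by linarith)
    apply mul_le_mul
    · linarith
    · have := mul_le_mul_of_nonneg_left (hbc.trans hcd.le) hq
      linarith
    · exact hwb
    · linarith

/-- Inversion swaps the two gaps and exchanges p and q. If the inverted gaps share a translate, the
induction hypothesis applies; otherwise the hull estimates decide. -/
theorem pair_cfSet_aux (n : ℕ) : ∀ a b c d p q : ℝ, IsGap cfSet a b → IsGap cfSet c d →
    cfLo ≤ a → b ≤ c → d ≤ cfHi → (4 / 5 : ℝ) ^ n < b - a → (4 / 5 : ℝ) ^ n < d - c →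
    0 ≤ q → q ≤ p → 0 < p →
    2.1 * (b - a) * (p + q * c) ≤ (c - b) * (p + q * a) ∨
    2.1 * (d - c) * (p + q * b) ≤ (c - b) * (p + q * d) := by
  have hlo := cfLo_gt
  have hlo' := cfLo_lt
  have hhi := cfHi_lt
  have hhi' := cfHi_gt
  induction n with
  | zero =>
    intro a b c d p q h h' ha hbc hd hn
    have := h'.lt
    rw [pow_zero] at hn
    linarith
  | succ n ih =>
    intro a b c d p q h h' ha hbc hd hn hn' hq hqp hp
    have hab := h.lt
    have hcd := h'.lt
    have hg := h.inv ha (by linarith)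
    have hg' := h'.inv (by linarith) hd
    have hm := pow_lt_inv_sub_inv ha hab (by linarith) hn
    have hm' := pow_lt_inv_sub_inv (by linarith) hcd hd hn'
    have hD1 := one_add_cfLo_le_inv (by linarith) hd
    have hA6 := inv_le_six_add_cfHi ha
    have ha0 : 0 < a := by linarith
    have hb0 : 0 < b := by linarith
    have hc0 : 0 < c := by linarith
    have hd0 : 0 < d := by linarith
    have haA : a * a⁻¹ = 1 := mul_inv_cancel₀ ha0.ne'
    have hbB : b * b⁻¹ = 1 := mul_inv_cancel₀ hb0.ne'
    have hcC : c * c⁻¹ = 1 := mul_inv_cancel₀ hc0.ne'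
    have hdD : d * d⁻¹ = 1 := mul_inv_cancel₀ hd0.ne'
    have hCB : c⁻¹ ≤ b⁻¹ := inv_anti₀ hb0 hbc
    set A := a⁻¹
    set B := b⁻¹
    set C := c⁻¹
    set D := d⁻¹
    have key := pair_cfSet_of_same (p := q) (q := p) (K := 1) hg' hg hCB hp.le
      (by push_cast; linarith) (by push_cast; linarith) (by push_cast; linarith) <| by
      intro k hk1 hk2 hk3
      have hk0 : (1 : ℝ) ≤ k := by exact_mod_cast hk1
      have := ih _ _ _ _ (q + p * k) p (hg'.add_int (-k)) (hg.add_int (-k))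
        (by push_cast; linarith) (by linarith) (by push_cast; linarith) (by linarith)
        (by linarith) hp.le (by nlinarith) (by nlinarith)
      push_cast at this
      rcases this with h | h
      · left; linarith
      · right; linarith
    have e1 : b - a = (A - B) * (a * b) := by linear_combination a * hbB - b * haA
    have e2 : d - c = (C - D) * (c * d) := by linear_combination c * hdD - d * hcC
    have e3 : c - b = (B - C) * (b * c) := by linear_combination b * hcC - c * hbB
    have e4 : p + q * a = a * (q + p * A) := by linear_combination (-p) * haA
    have e5 : p + q * b = b * (q + p * B) := by linear_combination (-p) * hbB
    have e6 : p + q * c = c * (q + p * C) := by linear_combination (-p) * hcC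
    have e7 : p + q * d = d * (q + p * D) := by linear_combination (-p) * hdD
    rcases key with key | key
    · right
      rw [e2, e3, e5, e7]
      have := mul_le_mul_of_nonneg_left key (by positivity : 0 ≤ b * c * d)
      linarith
    · left
      rw [e1, e3, e4, e6]
      have := mul_le_mul_of_nonneg_left key (by positivity : 0 ≤ a * b * c)
      linarith

theorem isThick_cfSet : IsThick 2.1 cfSet := by
  intro a b c d h h' hbc
  have hlo := cfLo_gt
  obtain ⟨n, hn⟩ := exists_pow_lt_of_lt_one (lt_min (sub_pos.2 h.lt) (sub_pos.2 h'.lt))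
    (by norm_num : (4 / 5 : ℝ) < 1)
  rw [lt_min_iff] at hn
  -- With q = 0 the weight is constant, and K need only satisfy K + cfLo ≤ a.
  have := pair_cfSet_of_same (p := 1) (q := 0) (K := ⌊a⌋ - 1) h h' hbc le_rfl
    (by push_cast; linarith [Int.floor_le a, cfLo_lt]) (by simp) (by simp) <| by
    intro k _ hk1 hk2
    have := pair_cfSet_aux n _ _ _ _ 1 0 (h.add_int (-k)) (h'.add_int (-k))
      (by push_cast; linarith) (by linarith) (by push_cast; linarith) (by linarith)
      (by linarith) le_rfl zero_le_one zero_lt_one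
    simpa using this
  simpa using this

theorem IsGap.of_cfFrac {a b : ℝ} (h : IsGap cfFrac a b) : IsGap cfSet a b := by
  refine ⟨cfFrac_subset_cfSet h.left_mem, cfFrac_subset_cfSet h.right_mem, h.lt, fun x hx => ?_⟩
  by_contra! hcon
  have h1 := (cfFrac_subset h.left_mem).1
  have h2 := (cfFrac_subset h.right_mem).2
  rcases h.le_or_le x (mem_cfFrac_of_mem_cfSet hx (by linarith) (by linarith)) with h | h <;>
    linarith

theorem isThick_cfFrac : IsThick 2.1 cfFrac :=
  fun a b c d h h' hbc => isThick_cfSet a b c d h.of_cfFrac h'.of_cfFrac hbc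

theorem isHullThick_cfFrac : IsHullThick 2.1 cfFrac cfLo cfHi := by
  intro a b h
  have := hull_cfSet (p := 1) (q := 0) (k := 0) h.of_cfFrac
    (by simpa using (cfFrac_subset h.left_mem).1)
    (by simpa using (cfFrac_subset h.right_mem).2) le_rfl (by simp) (by simp)
  simp only [Int.cast_zero, zero_add, zero_mul, add_zero, mul_one] at this
  exact ⟨this.2, this.1⟩

/-! ### Intersecting images with the continued fraction set, and the four equations. -/

theorem gap_cfSet_le {a b : ℝ} (h : IsGap cfSet a b) : b - a ≤ 0.5 := by
  have hlo := cfLo_lt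
  have hlo' := cfLo_gt
  have hhi := cfHi_gt
  have hhi' := cfHi_lt
  obtain ⟨k, ⟨h1, h2⟩ | ⟨h1, h2⟩⟩ := h.cfSet_cases
  · have := hull_cfSet (p := 1) (q := 0) h h1 h2 le_rfl (by simp) (by simp)
    simp only [zero_mul, add_zero, mul_one] at this
    linarith [this.1, h.lt]
  · linarith

theorem exists_mem_cfSet {A : Set ℝ} {σ p q c₁ c₂ : ℝ} {h : ℝ → ℝ} (hA : IsCompact A)
    (hp : p ∈ A) (hq : q ∈ A) (hpq : A ⊆ Set.Icc p q) (tA : IsThick σ A)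
    (hullA : IsHullThick σ A p q) (hσ : 0 < σ) (hc₁ : 0 < c₁) (hδ : 0.5 < c₁ * (q - p))
    (hcont : Continuous h)
    (hle : ∀ x y, p ≤ x → x ≤ y → y ≤ q → c₁ * (y - x) ≤ h y - h x ∧ h y - h x ≤ c₂ * (y - x))
    (hστ : c₂ ≤ c₁ * σ * 2.1) : ∃ x ∈ A, h x ∈ cfSet :=
  exists_mem_of_isThick hA isClosed_cfSet hp hq hpq tA hullA exists_mem_cfSet_le
    exists_mem_cfSet_ge isThick_cfSet (fun _ _ h => gap_cfSet_le h) hδ hσ (by norm_num) hc₁ hcont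
    hle hστ

open Pointwise in
theorem exists_neg_mem_cfSet {A : Set ℝ} {σ p q c₁ c₂ : ℝ} {h : ℝ → ℝ} (hA : IsCompact A)
    (hp : p ∈ A) (hq : q ∈ A) (hpq : A ⊆ Set.Icc p q) (tA : IsThick σ A)
    (hullA : IsHullThick σ A p q) (hσ : 0 < σ) (hc₁ : 0 < c₁) (hδ : 0.5 < c₁ * (q - p))
    (hcont : Continuous h)
    (hle : ∀ x y, p ≤ x → x ≤ y → y ≤ q → c₁ * (y - x) ≤ h y - h x ∧ h y - h x ≤ c₂ * (y - x))
    (hστ : c₂ ≤ c₁ * σ * 2.1) : ∃ x ∈ A, -h x ∈ cfSet := by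
  refine exists_mem_of_isThick (B := -cfSet) hA isClosed_cfSet.neg hp hq hpq tA hullA
    (fun x => ?_) (fun x => ?_) isThick_cfSet.neg (fun a b h => ?_) hδ hσ (by norm_num) hc₁ hcont
    hle hστ
  · obtain ⟨y, hy, hxy⟩ := exists_mem_cfSet_ge (-x)
    exact ⟨-y, by simpa using hy, by linarith⟩
  · obtain ⟨y, hy, hxy⟩ := exists_mem_cfSet_le (-x)
    exact ⟨-y, by simpa using hy, by linarith⟩
  · linarith [gap_cfSet_le h.of_neg]

theorem cube_bounds {x y : ℝ} (hx : cfLo ≤ x) (hxy : x ≤ y) (hy : y ≤ cfHi) :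
    3.93 * (y - x) ≤ (y + 1) ^ 3 - (x + 1) ^ 3 ∧
    (y + 1) ^ 3 - (x + 1) ^ 3 ≤ 10.53 * (y - x) := by
  have hlo := cfLo_gt
  have hhi := cfHi_lt
  have e : (y + 1) ^ 3 - (x + 1) ^ 3 =
      ((y + 1) ^ 2 + (y + 1) * (x + 1) + (x + 1) ^ 2) * (y - x) := by ring
  have hyx := sub_nonneg.2 hxy
  rw [e]
  constructor <;> apply mul_le_mul_of_nonneg_right _ hyx <;> nlinarith

theorem square_bounds {x y : ℝ} (hx : 0 ≤ x) (hxy : x ≤ y) (hy : y ≤ 1) :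
    1 * (y - x) ≤ (y + 1) ^ 2 / 2 - (x + 1) ^ 2 / 2 ∧
    (y + 1) ^ 2 / 2 - (x + 1) ^ 2 / 2 ≤ 2 * (y - x) := by
  have e : (y + 1) ^ 2 / 2 - (x + 1) ^ 2 / 2 = ((x + y) / 2 + 1) * (y - x) := by ring
  have hyx := sub_nonneg.2 hxy
  rw [e]
  constructor <;> apply mul_le_mul_of_nonneg_right _ hyx <;> linarith

theorem corollary1p8 :
    {w : ℝ | ∃ x ∈ contFractSet 7, ∃ y ∈ contFractSet 7, w = x ^ 3 + y} = Set.univ ∧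
    {w : ℝ | ∃ x ∈ contFractSet 7, ∃ y ∈ contFractSet 7, w = x ^ 3 - y} = Set.univ ∧
    {w : ℝ | ∃ x ∈ cantorSetAddOne, ∃ y ∈ contFractSet 6, w = x ^ 2 + 2 * y} = Set.univ ∧
    {w : ℝ | ∃ x ∈ cantorSetAddOne, ∃ y ∈ cantorSetAddOne, ∃ z ∈ contFractSet 6,
      w = (0.1 : ℝ) * x + x * y + z} = Set.univ := by
  have h7 : cfSet ⊆ contFractSet 7 := cfSet_subset_contFractSet (by norm_num)
  have h6 : cfSet ⊆ contFractSet 6 := cfSet_subset_contFractSet le_rfl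
  have hlen : 0.5 < 3.93 * (cfHi - cfLo) := by linarith [cfHi_gt, cfLo_lt]
  have hfrac : ∀ x ∈ cfFrac, x + 1 ∈ contFractSet 7 := fun x hx => by
    have := add_int_mem_cfSet (cfFrac_subset_cfSet hx) 1
    exact h7 (by exact_mod_cast this)
  simp only [Set.eq_univ_iff_forall, Set.mem_ofPred_eq]
  refine ⟨fun w => ?_, fun w => ?_, fun w => ?_, fun w => ?_⟩
  · obtain ⟨x, hx, hy⟩ := exists_neg_mem_cfSet (h := fun x => (x + 1) ^ 3 - w) isCompact_cfFrac
      cfLo_mem cfHi_mem cfFrac_subset isThick_cfFrac isHullThick_cfFrac (by norm_num)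
      (by norm_num : (0 : ℝ) < 3.93) hlen (by fun_prop)
      (fun x y hx hxy hy => by simpa using cube_bounds hx hxy hy) (by norm_num)
    exact ⟨x + 1, hfrac x hx, _, h7 hy, by ring⟩
  · obtain ⟨x, hx, hy⟩ := exists_mem_cfSet (h := fun x => (x + 1) ^ 3 - w) isCompact_cfFrac
      cfLo_mem cfHi_mem cfFrac_subset isThick_cfFrac isHullThick_cfFrac (by norm_num)
      (by norm_num : (0 : ℝ) < 3.93) hlen (by fun_prop)
      (fun x y hx hxy hy => by simpa using cube_bounds hx hxy hy) (by norm_num)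
    exact ⟨x + 1, hfrac x hx, _, h7 hy, by ring⟩
  -- Halving the equation leaves y with coefficient 1, so `cfSet` need not be rescaled.
  · obtain ⟨x, hx, hy⟩ := exists_neg_mem_cfSet (h := fun x => (x + 1) ^ 2 / 2 - w / 2)
      isCompact_cantorSet zero_mem_cantorSet one_mem_cantorSet cantorSet_subset_unitInterval
      isThick_cantorSet isHullThick_cantorSet one_pos one_pos (by norm_num) (by fun_prop)
      (fun x y hx hxy hy => by simpa using square_bounds hx hxy hy) (by norm_num)
    exact ⟨x + 1, ⟨x, hx, rfl⟩, _, h6 hy, by ring⟩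
  -- The first variable is fixed at 1, so 0.1 + (x + 1) = x + 1.1 remains, with slope 1.
  · obtain ⟨x, hx, hy⟩ := exists_neg_mem_cfSet (h := fun x => x + 1.1 - w) (c₁ := 1) (c₂ := 1)
      isCompact_cantorSet zero_mem_cantorSet one_mem_cantorSet cantorSet_subset_unitInterval
      isThick_cantorSet isHullThick_cantorSet one_pos one_pos (by norm_num) (by fun_prop)
      (fun x y hx hxy hy => by constructor <;> linarith) (by norm_num)
    exact ⟨0 + 1, ⟨0, zero_mem_cantorSet, rfl⟩, x + 1, ⟨x, hx, rfl⟩, _, h6 hy, by ring⟩
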